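/- In the unit triangular lattice with horizontal lattice lines, a lozenge is the union of two unit triangles sharing an edge, and a set of unit triangles is tileable if it can be covered by pairwise non-overlapping lozenges contained in it. For integers $a,b,n\ge 0$ and integers $1\le u_1<u_2<\dots<u_n\le b+2n$, let $H$ be obtained from the equiangular lattice hexagon with side lengths $2a,\ b+2n,\ b,\ 2a+2n,\ b,\ b+2n$, clockwise from the northern side, by removing, for each $i$, the $u_i$th unit triangle from the north among those sharing an edge with the northeast side, and likewise the $u_i$th among those sharing an edge with the northwest side. Let $V_{a,b,n,(u_i)_1^n}$ (a dented half-hexagon) be the set of unit triangles of $H$ whose interiors lie strictly west of the vertical symmetry axis of $H$. Let $n,a,b,a',b'\ge 0$ be integers, and let $V_{a,b,n,(u_i)_1^n}$ and $V_{a',b',n,(u'_i)_1^n}$ be dented half-hexagons (so $1\le u_1<\dots<u_n\le b+2n$ and $1\le u'_1<\dots<u'_n\le b'+2n$) with $u_i\le u'_i$ for all $i\in\{1,\dots,n\}$. If $V_{a,b,n,(u_i)_1^n}$ is tileable, then so is $V_{a',b',n,(u'_i)_1^n}$. -/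

import Mathlib

namespace LozengeTiling

/-- Vertices of the unit triangular lattice with horizontal lattice lines. The pair `(i, k)` is the
point reached from the origin by `i` unit steps east and `k` unit steps southwest. It lies on the
`k`-th horizontal lattice line south of the origin, and its Cartesian abscissa is `i - k / 2`.
The unit step southeast is `(1, 1)`. -/
abbrev Vertex : Type := ℤ × ℤ

/-- The unit triangles of the lattice. `up i k` is the up-pointing triangle with apex `(i, k)`;
`down i k` is the down-pointing triangle whose horizontal side has west endpoint `(i, k)`. -/
inductive Triangle : Type
  | up (i k : ℤ) : Triangle
  | down (i k : ℤ) : Triangle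

/-- The three corners of a unit triangle. -/
def Triangle.vertices : Triangle → Finset Vertex
  | .up i k => {(i, k), (i, k + 1), (i + 1, k + 1)}
  | .down i k => {(i, k), (i + 1, k), (i + 1, k + 1)}

/-- Two unit triangles are adjacent if they share an edge, i.e. have exactly two common corners. -/
def Adjacent (T T' : Triangle) : Prop :=
  (T.vertices ∩ T'.vertices).card = 2

/-- A lozenge is the union of two adjacent triangles. (Unions of lattice triangles are
represented as sets of triangles.) -/
def IsLozenge (l : Set Triangle) : Prop :=
  ∃ T T' : Triangle, Adjacent T T' ∧ l = {T, T'}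

/-- A lozenge tiling of `R`: a family of pairwise non-overlapping lozenges within `R` that
covers `R`. -/
structure IsTiling (R : Set Triangle) (L : Set (Set Triangle)) : Prop where
  lozenge : ∀ l ∈ L, IsLozenge l
  within : ∀ l ∈ L, l ⊆ R
  nonoverlapping : L.PairwiseDisjoint id
  covers : R ⊆ ⋃₀ L

/-- A set of triangles is tileable if it has a lozenge tiling. -/
def Tileable (R : Set Triangle) : Prop :=
  ∃ L : Set (Set Triangle), IsTiling R L

/-- The vertices in the closed equiangular hexagon with side lengths
`a, b + t, c, a + t, b, c + t`, clockwise from the northern side, placed so that the west end of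
the northern side is the origin. Its corners, clockwise, are `(0, 0)`, `(a, 0)`,
`(a + b + t, b + t)`, `(a + b + t, b + c + t)`, `(b, b + c + t)`, `(0, c + t)`. The inequalities
describe the half-planes of, respectively, the N and S, NW and SE, NE and SW sides. -/
def hexagonVertices (a b c t : ℕ) : Set Vertex :=
  {p | (0 ≤ p.2 ∧ p.2 ≤ b + c + t) ∧
       (0 ≤ p.1 ∧ p.1 ≤ a + b + t) ∧
       (p.1 - p.2 ≤ a ∧ p.2 - p.1 ≤ c + t)}

/-- The hexagonal region `H_{a,b,c,t}`: the unit triangles inside the hexagon. -/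
def hexagon (a b c t : ℕ) : Set Triangle :=
  {T | ∀ p ∈ T.vertices, p ∈ hexagonVertices a b c t}

/-- The `v`-th triangle, from the north, having an edge on the northwest border. Its edge on the
border joins `(0, v - 1)` and `(0, v)`. -/
def northwestTriangle (v : ℤ) : Triangle := .up 0 (v - 1)

/-- The `u`-th triangle, from the north, having an edge on the northeast border of a hexagon whose
northern side has length `a`. Its edge on the border joins `(a + u - 1, u - 1)` and
`(a + u, u)`. -/
def northeastTriangle (a : ℕ) (u : ℤ) : Triangle := .up (a + u - 1) (u - 1)

/-- `u` lists dent positions along a side of length `s`: `1 ≤ u₁ < u₂ < ⋯ < uₙ ≤ s`. -/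
def IsDentVector (s : ℕ) {n : ℕ} (u : Fin n → ℤ) : Prop :=
  StrictMono u ∧ ∀ i, 1 ≤ u i ∧ u i ≤ s

/-- The dented hexagon `H_{a,b,c,t,(u_i),(v_j)}`: dents at positions `u` along the northeast
border and at positions `v` along the northwest border are removed from `H_{a,b,c,t}`. -/
def dentedHexagon (a b c t : ℕ) {m n : ℕ} (u : Fin m → ℤ) (v : Fin n → ℤ) : Set Triangle :=
  hexagon a b c t \
    (Set.range (fun i => northeastTriangle a (u i)) ∪ Set.range (fun j => northwestTriangle (v j)))

/-- The interior of `T` lies strictly west of the vertical line of abscissa `x`; equivalently all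
corners of `T` lie weakly west of it. The abscissa of `(i, k)` is `i - k / 2`. -/
def Triangle.StrictlyWest (T : Triangle) (x : ℤ) : Prop :=
  ∀ p ∈ T.vertices, 2 * p.1 - p.2 ≤ 2 * x

/-- The dented half-hexagon `V_{a,b,t,(u_i)}`: the triangles of the vertically symmetric dented
hexagon `H_{2a,b,b,2t,(u_i),(u_i)}` whose interiors are strictly west of its vertical axis of
symmetry. The axis passes through the midpoint `(a, 0)` of the northern side. -/
def dentedHalfHexagon (a b t : ℕ) {n : ℕ} (u : Fin n → ℤ) : Set Triangle :=
  {T | T ∈ dentedHexagon (2 * a) b b (2 * t) u u ∧ T.StrictlyWest a}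

end LozengeTiling

namespace LozengeTiling

/-! ### Adjacency of triangles -/

/-! Tileability has a criterion that does not involve `a` or `b`: the `j`-th dent from the north
(counted from 1) lies at position at least `2 * j`. It survives moving dents south, so the theorem
follows. Necessity is a count. The partner of an up triangle lies in its row or the next row south,
so south of any lattice line the up triangles inject into the down triangles. Taking the line at
depth `u j`, `card_upsSouth_sub_card_downsSouth` turns this into the bound. Sufficiency is an
explicit tiling. Balance forces `k / 2 - dentCount u k - max 0 (k - (b + 2 * n))` vertical lozenges
across the line `k`. When the criterion makes these numbers nonnegative, push those lozenges against
the axis and pair the rest of each row horizontally. -/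

theorem Adjacent.symm {T T' : Triangle} (h : Adjacent T T') : Adjacent T' T := by
  unfold Adjacent at *
  rwa [Finset.inter_comm]

theorem adjacent_up_down_self (i k : ℤ) : Adjacent (.up i k) (.down i k) := by
  have : Triangle.vertices (.up i k) ∩ Triangle.vertices (.down i k)
      = {(i, k), (i + 1, k + 1)} := by
    ext ⟨x, y⟩
    simp only [Triangle.vertices, Finset.mem_inter, Finset.mem_insert, Finset.mem_singleton,
      Prod.mk.injEq]
    omega
  rw [Adjacent, this]
  exact Finset.card_pair (by simp)

theorem adjacent_up_down_west (i k : ℤ) : Adjacent (.up (i + 1) k) (.down i k) := by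
  have : Triangle.vertices (.up (i + 1) k) ∩ Triangle.vertices (.down i k)
      = {(i + 1, k), (i + 1, k + 1)} := by
    ext ⟨x, y⟩
    simp only [Triangle.vertices, Finset.mem_inter, Finset.mem_insert, Finset.mem_singleton,
      Prod.mk.injEq]
    omega
  rw [Adjacent, this]
  exact Finset.card_pair (by simp)

theorem adjacent_up_down_south (i k : ℤ) : Adjacent (.up i k) (.down i (k + 1)) := by
  have : Triangle.vertices (.up i k) ∩ Triangle.vertices (.down i (k + 1))
      = {(i, k + 1), (i + 1, k + 1)} := by
    ext ⟨x, y⟩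
    simp only [Triangle.vertices, Finset.mem_inter, Finset.mem_insert, Finset.mem_singleton,
      Prod.mk.injEq]
    omega
  rw [Adjacent, this]
  exact Finset.card_pair (by simp)

theorem card_vertices (T : Triangle) : T.vertices.card = 3 := by
  cases T <;> exact Finset.card_eq_three.2 ⟨_, _, _, by simp, by simp, by simp, rfl⟩

theorem Adjacent.ne {T T' : Triangle} (h : Adjacent T T') : T ≠ T' := by
  rintro rfl
  rw [Adjacent, Finset.inter_self, card_vertices] at h
  omega

/-- A triangle adjacent to an up-pointing triangle is down-pointing, and lies in the same row or
in the next one to the south. -/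
theorem Adjacent.exists_down {i k : ℤ} {T : Triangle} (h : Adjacent (.up i k) T) :
    ∃ i' k', T = .down i' k' ∧ (k' = k ∨ k' = k + 1) := by
  obtain ⟨⟨x, y⟩, ⟨x', y'⟩, hne, he⟩ := Finset.card_eq_two.1 h
  have h1 : (x, y) ∈ Triangle.vertices (.up i k) ∩ T.vertices := by simp [he]
  have h2 : (x', y') ∈ Triangle.vertices (.up i k) ∩ T.vertices := by simp [he]
  cases T with
  | up i' k' =>
    have hT := h.ne
    simp only [Triangle.vertices, Finset.mem_inter, Finset.mem_insert, Finset.mem_singleton,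
      Prod.mk.injEq, ne_eq, Triangle.up.injEq] at h1 h2 hne hT
    omega
  | down i' k' =>
    refine ⟨i', k', rfl, ?_⟩
    simp only [Triangle.vertices, Finset.mem_inter, Finset.mem_insert, Finset.mem_singleton,
      Prod.mk.injEq, ne_eq] at h1 h2 hne
    omega

/-! ### Tilings as perfect matchings -/

/-- A fixed-point-free involution of `R` that sends triangles to adjacent ones gives a tiling. -/
theorem tileable_of_involution {R : Set Triangle} (f : Triangle → Triangle)
    (hf : ∀ T ∈ R, f T ∈ R ∧ Adjacent T (f T) ∧ f (f T) = T) : Tileable R := by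
  refine ⟨(fun T => {T, f T}) '' R, ?_, ?_, ?_, ?_⟩
  · rintro _ ⟨T, hT, rfl⟩
    exact ⟨T, f T, (hf T hT).2.1, rfl⟩
  · rintro _ ⟨T, hT, rfl⟩
    exact Set.insert_subset hT (Set.singleton_subset_iff.2 (hf T hT).1)
  · rintro _ ⟨T, hT, rfl⟩ _ ⟨T', hT', rfl⟩ hne
    refine Set.disjoint_left.2 fun S hS hS' => hne ?_
    have key : ∀ T ∈ R, S ∈ ({T, f T} : Set Triangle) → ({T, f T} : Set Triangle) = {S, f S} := by
      rintro T hT (rfl | hS)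
      · rfl
      · rw [Set.mem_singleton_iff.1 hS, (hf T hT).2.2, Set.pair_comm]
    exact (key T hT hS).trans (key T' hT' hS').symm
  · exact fun T hT => ⟨_, ⟨T, hT, rfl⟩, Set.mem_insert _ _⟩

/-- In a tileable region, every triangle has a partner, and distinct triangles have distinct
partners. -/
theorem Tileable.exists_partner {R : Set Triangle} (h : Tileable R) :
    ∃ f : Triangle → Triangle, Set.InjOn f R ∧ ∀ T ∈ R, f T ∈ R ∧ Adjacent T (f T) := by
  obtain ⟨L, hL⟩ := h
  have hex : ∀ T ∈ R, ∃ T', Adjacent T T' ∧ ({T, T'} : Set Triangle) ∈ L := by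
    intro T hT
    obtain ⟨l, hl, hTl⟩ := hL.covers hT
    obtain ⟨A, B, hAB, rfl⟩ := hL.lozenge l hl
    rcases hTl with rfl | hTB
    · exact ⟨B, hAB, hl⟩
    · rw [Set.mem_singleton_iff] at hTB
      subst hTB
      exact ⟨A, hAB.symm, by rwa [Set.pair_comm]⟩
  choose! f hf using hex
  refine ⟨f, ?_, fun T hT => ⟨hL.within _ (hf T hT).2 (by simp), (hf T hT).1⟩⟩
  intro T hT T' hT' heq
  have hsame : ({T, f T} : Set Triangle) = {T', f T'} := by
    by_contra hne
    exact Set.disjoint_left.1 (hL.nonoverlapping (hf T hT).2 (hf T' hT').2 hne)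
      (show f T ∈ ({T, f T} : Set Triangle) by simp) (by simp [heq])
  have hmem : T ∈ ({T', f T'} : Set Triangle) := hsame ▸ Set.mem_insert _ _
  rcases hmem with rfl | hmem
  · rfl
  · exact absurd ((Set.mem_singleton_iff.1 hmem).trans heq.symm) (hf T hT).1.ne

/-! ### Dented half-hexagons in coordinates -/

section

variable {a b n : ℕ} {u : Fin n → ℤ}

theorem up_mem_dentedHalfHexagon (hu : IsDentVector (b + 2 * n) u) {i k : ℤ} :
    Triangle.up i k ∈ dentedHalfHexagon a b n u ↔
      0 ≤ k ∧ k < 2 * b + 2 * n ∧ 0 ≤ i ∧ k + 1 - (b + 2 * n) ≤ i ∧ 2 * i + 1 - k ≤ 2 * a ∧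
        ¬ (i = 0 ∧ ∃ j, u j = k + 1) := by
  simp only [dentedHalfHexagon, dentedHexagon, hexagon, hexagonVertices, Triangle.StrictlyWest,
    Triangle.vertices, northwestTriangle, northeastTriangle, Set.mem_ofPred_eq, Set.mem_sdiff,
    Set.mem_union, Set.mem_range, Finset.mem_insert, Finset.mem_singleton, forall_eq_or_imp,
    forall_eq, Triangle.up.injEq]
  push_cast
  constructor
  · rintro ⟨⟨h1, h2⟩, h3⟩
    refine ⟨by omega, by omega, by omega, by omega, by omega, ?_⟩
    rintro ⟨rfl, j, hj⟩
    exact h2 (Or.inr ⟨j, rfl, by omega⟩)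
  · rintro ⟨h1, h2, h3, h4, h5, h6⟩
    refine ⟨⟨by omega, ?_⟩, by omega⟩
    -- A northeast dent lies east of the axis, so only northwest dents matter.
    rintro (⟨j, hj1, hj2⟩ | ⟨j, hj1, hj2⟩)
    · have := (hu.2 j).1
      omega
    · exact h6 ⟨hj1.symm, j, by omega⟩

theorem down_mem_dentedHalfHexagon {i k : ℤ} :
    Triangle.down i k ∈ dentedHalfHexagon a b n u ↔
      0 ≤ k ∧ k < 2 * b + 2 * n ∧ 0 ≤ i ∧ k - (b + 2 * n) ≤ i ∧ 2 * i + 2 - k ≤ 2 * a := by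
  simp only [dentedHalfHexagon, dentedHexagon, hexagon, hexagonVertices, Triangle.StrictlyWest,
    Triangle.vertices, northwestTriangle, northeastTriangle, Set.mem_ofPred_eq, Set.mem_sdiff,
    Set.mem_union, Set.mem_range, Finset.mem_insert, Finset.mem_singleton, forall_eq_or_imp,
    forall_eq, reduceCtorEq, exists_false, or_self, not_false_eq_true, and_true]
  push_cast
  omega

/-! ### Counting dents -/

/-- The number of dents among the `k` northernmost positions. -/
def dentCount {n : ℕ} (u : Fin n → ℤ) (k : ℤ) : ℤ :=
  (Finset.univ.filter fun j => u j ≤ k).card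

theorem dentCount_nonneg (k : ℤ) : 0 ≤ dentCount u k := Int.natCast_nonneg _

theorem dentCount_add_one_of_dent (hu : StrictMono u) {k : ℤ} (h : ∃ j, u j = k + 1) :
    dentCount u (k + 1) = dentCount u k + 1 := by
  obtain ⟨j, hj⟩ := h
  have : (Finset.univ.filter fun j => u j ≤ k + 1)
      = insert j (Finset.univ.filter fun j => u j ≤ k) := by
    ext l
    have : l = j ↔ u l = u j := hu.injective.eq_iff.symm
    simp only [Finset.mem_filter, Finset.mem_univ, true_and, Finset.mem_insert]
    omega
  rw [dentCount, this, Finset.card_insert_of_notMem (by simp [hj])]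
  rfl

theorem dentCount_add_one_of_not_dent {k : ℤ} (h : ¬ ∃ j, u j = k + 1) :
    dentCount u (k + 1) = dentCount u k := by
  rw [dentCount, dentCount]
  refine congrArg (fun s : Finset (Fin n) => (s.card : ℤ)) (Finset.filter_congr fun l _ => ?_)
  have : u l ≠ k + 1 := fun hl => h ⟨l, hl⟩
  omega

theorem dentCount_of_le (hu : IsDentVector (b + 2 * n) u) {k : ℤ} (hk : b + 2 * n ≤ k) :
    dentCount u k = n := by
  rw [dentCount, Finset.filter_true_of_mem, Finset.card_univ, Fintype.card_fin]
  intro j _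
  have := (hu.2 j).2
  push_cast at this
  omega

theorem dentCount_apply (hu : StrictMono u) (j : Fin n) : dentCount u (u j) = j + 1 := by
  have : (Finset.univ.filter fun l => u l ≤ u j) = Finset.Iic j := by
    ext l
    simp [hu.le_iff_le]
  rw [dentCount, this, Fin.card_Iic]
  push_cast
  rfl

/-- A dent at position at most `k` has index below `k / 2`, and indices are distinct. -/
theorem two_mul_dentCount_le (h : ∀ j : Fin n, 2 * ((j : ℤ) + 1) ≤ u j) {k : ℤ} (hk : 0 ≤ k) :
    2 * dentCount u k ≤ k := by
  have : (Finset.univ.filter fun j => u j ≤ k).card ≤ (Finset.range (k / 2).toNat).card := by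
    refine Finset.card_le_card_of_injOn (fun j => (j : ℕ)) ?_ Fin.val_injective.injOn
    intro j hj
    have h1 := h j
    simp only [Finset.coe_filter, Finset.mem_univ, true_and, Set.mem_ofPred_eq] at hj
    simp only [Finset.coe_range, Set.mem_Iio]
    omega
  rw [Finset.card_range] at this
  rw [dentCount]
  omega

/-! ### Existence of a tiling -/

/-- The index of the first vertical lozenge crossing the `k`-th lattice line in the tiling whose
vertical lozenges are pushed against the axis of symmetry. -/
def lozengeStart (a b : ℕ) {n : ℕ} (u : Fin n → ℤ) (k : ℤ) : ℤ :=
  a + dentCount u k + max 0 (k - (b + 2 * n))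

/-- The partner of a triangle in the tiling whose vertical lozenges are pushed against the axis of
symmetry. -/
def partner (a b : ℕ) {n : ℕ} (u : Fin n → ℤ) : Triangle → Triangle
  | .up i k =>
    if lozengeStart a b u (k + 1) ≤ i then .down i (k + 1)
    else if lozengeStart a b u (k + 1) = lozengeStart a b u k then .down i k
    else .down (i - 1) k
  | .down i k =>
    if lozengeStart a b u k ≤ i then .up i (k - 1)
    else if lozengeStart a b u (k + 1) = lozengeStart a b u k then .up i k
    else .up (i + 1) k

/-- The start moves east exactly when row `k` lacks its westernmost up triangle, through a dent or
because the border is now the southwest side; the horizontal pairing then shifts by one. -/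
theorem lozengeStart_add_one (hu : IsDentVector (b + 2 * n) u) (k : ℤ) :
    (lozengeStart a b u (k + 1) = lozengeStart a b u k ∧ k < b + 2 * n ∧ ¬ ∃ j, u j = k + 1) ∨
      (lozengeStart a b u (k + 1) = lozengeStart a b u k + 1 ∧
        (b + 2 * n ≤ k ∨ ∃ j, u j = k + 1)) := by
  simp only [lozengeStart]
  by_cases hd : ∃ j, u j = k + 1
  · rw [dentCount_add_one_of_dent hu.1 hd]
    obtain ⟨j, hj⟩ := hd
    have := (hu.2 j).2
    push_cast at this
    exact Or.inr ⟨by omega, Or.inr ⟨j, hj⟩⟩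
  · rw [dentCount_add_one_of_not_dent hd]
    by_cases hk : k < b + 2 * n
    · exact Or.inl ⟨by omega, hk, hd⟩
    · exact Or.inr ⟨by omega, Or.inl (by omega)⟩

/-- The upper bound says that the number of vertical lozenges across line `k` is nonnegative. South
of the west corner it reduces to `k ≤ 2 * b + 2 * n`. -/
theorem lozengeStart_bounds (hu : IsDentVector (b + 2 * n) u)
    (h : ∀ j : Fin n, 2 * ((j : ℤ) + 1) ≤ u j) {k : ℤ} (hk : 0 ≤ k) (hk' : k ≤ 2 * b + 2 * n) :
    a + max 0 (k - (b + 2 * n)) ≤ lozengeStart a b u k ∧ 2 * lozengeStart a b u k ≤ 2 * a + k := by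
  have h0 := dentCount_nonneg (u := u) k
  have h1 := two_mul_dentCount_le h hk
  simp only [lozengeStart]
  by_cases hkm : b + 2 * n ≤ k
  · have := dentCount_of_le hu hkm
    omega
  · omega

theorem tileable_dentedHalfHexagon (hu : IsDentVector (b + 2 * n) u)
    (h : ∀ j : Fin n, 2 * ((j : ℤ) + 1) ≤ u j) : Tileable (dentedHalfHexagon a b n u) := by
  have hend : lozengeStart a b u (2 * b + 2 * n) = a + b + n := by
    rw [lozengeStart, dentCount_of_le hu (by omega)]
    omega
  refine tileable_of_involution (partner a b u) ?_
  rintro (⟨i, k⟩ | ⟨i, k⟩) hT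
  · rw [up_mem_dentedHalfHexagon hu] at hT
    obtain ⟨h1, h2, h3, h4, h5, h6⟩ := hT
    have hb := lozengeStart_bounds (a := a) hu h h1 (by omega)
    have hb' := lozengeStart_bounds (a := a) hu h (k := k + 1) (by omega) (by omega)
    by_cases hv : lozengeStart a b u (k + 1) ≤ i
    -- No vertical lozenge crosses the southern side: by `hend` its start is already at the axis.
    · have hk : k + 1 ≠ 2 * b + 2 * n := by
        intro hk
        rw [hk, hend] at hv
        omega
      simp only [partner, if_pos hv, down_mem_dentedHalfHexagon, add_sub_cancel_right, and_true]
      exact ⟨by omega, adjacent_up_down_south i k⟩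
    · rcases lozengeStart_add_one (a := a) hu k with ⟨he, hk, hd⟩ | ⟨he, hd⟩
      · have hv' : ¬ lozengeStart a b u k ≤ i := by omega
        simp only [partner, if_neg hv, if_neg hv', if_pos he, down_mem_dentedHalfHexagon, and_true]
        exact ⟨by omega, adjacent_up_down_self i k⟩
      · have hv' : ¬ lozengeStart a b u k ≤ i - 1 := by omega
        have he' : ¬ lozengeStart a b u (k + 1) = lozengeStart a b u k := by omega
        have hi : i ≠ 0 := by
          rintro rfl
          rcases hd with hd | hd
          · omega
          · exact h6 ⟨rfl, hd⟩
        simp only [partner, if_neg hv, if_neg hv', if_neg he', down_mem_dentedHalfHexagon,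
          sub_add_cancel, and_true]
        refine ⟨by omega, ?_⟩
        simpa using adjacent_up_down_west (i - 1) k
  · rw [down_mem_dentedHalfHexagon] at hT
    obtain ⟨h1, h2, h3, h4, h5⟩ := hT
    have hb := lozengeStart_bounds (a := a) hu h h1 (by omega)
    have hb' := lozengeStart_bounds (a := a) hu h (k := k + 1) (by omega) (by omega)
    by_cases hv : lozengeStart a b u k ≤ i
    · have hk : k ≠ 0 := by
        rintro rfl
        omega
      simp only [partner, if_pos hv, up_mem_dentedHalfHexagon hu, sub_add_cancel, and_true]
      refine ⟨⟨by omega, by omega, by omega, by omega, by omega, ?_⟩, ?_⟩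
      -- A vertical lozenge never uses a dent: a dent just north of line `k` makes the start
      -- positive.
      · rintro ⟨rfl, hd⟩
        have hs := dentCount_add_one_of_dent hu.1 (k := k - 1) (by simpa using hd)
        have h0 := dentCount_nonneg (u := u) (k - 1)
        rw [sub_add_cancel] at hs
        simp only [lozengeStart] at hv
        omega
      · simpa using (adjacent_up_down_south i (k - 1)).symm
    · rcases lozengeStart_add_one (a := a) hu k with ⟨he, hk, hd⟩ | ⟨he, hd⟩
      · have hv' : ¬ lozengeStart a b u (k + 1) ≤ i := by omega
        simp only [partner, if_neg hv, if_neg hv', if_pos he, up_mem_dentedHalfHexagon hu, and_true]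
        exact ⟨⟨by omega, by omega, by omega, by omega, by omega, fun hd' => hd hd'.2⟩,
          (adjacent_up_down_self i k).symm⟩
      · have hv' : ¬ lozengeStart a b u (k + 1) ≤ i + 1 := by omega
        have he' : ¬ lozengeStart a b u (k + 1) = lozengeStart a b u k := by omega
        simp only [partner, if_neg hv, if_neg hv', if_neg he', up_mem_dentedHalfHexagon hu,
          add_sub_cancel_right, and_true]
        exact ⟨⟨by omega, by omega, by omega, by omega, by omega, fun hd' => by omega⟩,
          (adjacent_up_down_west i k).symm⟩

/-! ### A necessary condition -/

/-- The coordinates `⟨k, i⟩` of the up-pointing triangles of a dented half-hexagon south of the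
`k₀`-th lattice line. -/
noncomputable def upsSouth (a b : ℕ) {n : ℕ} (u : Fin n → ℤ) (k₀ : ℤ) : Finset (Σ _ : ℤ, ℤ) :=
  (Finset.Ico k₀ (2 * b + 2 * n)).sigma fun k =>
    Finset.Ico (dentCount u (k + 1) - dentCount u k + max 0 (k + 1 - (b + 2 * n)))
      (a + (k + 1) / 2)

/-- The coordinates `⟨k, i⟩` of the down-pointing triangles of a dented half-hexagon south of the
`k₀`-th lattice line. -/
noncomputable def downsSouth (a b n : ℕ) (k₀ : ℤ) : Finset (Σ _ : ℤ, ℤ) :=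
  (Finset.Ico k₀ (2 * b + 2 * n)).sigma fun k =>
    Finset.Ico (max 0 (k - (b + 2 * n))) (a + k / 2)

theorem sum_Ico_int_sub (g : ℤ → ℤ) {p q : ℤ} (hpq : p ≤ q) :
    ∑ k ∈ Finset.Ico p q, (g (k + 1) - g k) = g q - g p := by
  induction q, hpq using Int.leInduction with
  | base => simp
  | succ q hq ih =>
    rw [← Finset.insert_Ico_right_eq_Ico_add_one hq, Finset.sum_insert (by simp), ih]
    ring

theorem card_upsSouth_sub_card_downsSouth (hu : IsDentVector (b + 2 * n) u) {k₀ : ℤ}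
    (h0 : 0 ≤ k₀) (h1 : k₀ ≤ b + 2 * n) (h2 : k₀ ≤ 2 * b + 2 * n) :
    dentCount u k₀ - k₀ / 2 ≤ (upsSouth a b u k₀).card - (downsSouth a b n k₀).card := by
  rw [upsSouth, downsSouth, Finset.card_sigma, Finset.card_sigma]
  push_cast
  rw [← Finset.sum_sub_distrib]
  -- The number of vertical lozenges across line `k`. Its increments are the row-by-row excess of up
  -- over down triangles, up to truncation of an empty row, whence only an inequality.
  let g : ℤ → ℤ := fun k => k / 2 - dentCount u k - max 0 (k - (b + 2 * n))
  have hg : g (2 * b + 2 * n) - g k₀ = dentCount u k₀ - k₀ / 2 := by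
    simp only [g, dentCount_of_le hu (show (b : ℤ) + 2 * n ≤ 2 * b + 2 * n by omega)]
    omega
  rw [← hg, ← sum_Ico_int_sub g h2]
  refine Finset.sum_le_sum fun k hk => ?_
  rw [Finset.mem_Ico] at hk
  simp only [g, Int.card_Ico]
  omega

theorem two_mul_le_of_tileable (hu : IsDentVector (b + 2 * n) u)
    (h : Tileable (dentedHalfHexagon a b n u)) (j : Fin n) : 2 * ((j : ℤ) + 1) ≤ u j := by
  obtain ⟨f, hinj, hf⟩ := h.exists_partner
  have hj := hu.2 j
  push_cast at hj
  by_cases hend : 2 * (b : ℤ) + 2 * n < u j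
  · have := j.2
    omega
  have hups : ∀ x ∈ upsSouth a b u (u j),
      Triangle.up x.2 x.1 ∈ dentedHalfHexagon a b n u ∧ u j ≤ x.1 := by
    rintro ⟨k, i⟩ hx
    simp only [upsSouth, Finset.mem_sigma, Finset.mem_Ico] at hx
    rw [up_mem_dentedHalfHexagon hu]
    dsimp only
    by_cases hd : ∃ l, u l = k + 1
    · rw [dentCount_add_one_of_dent hu.1 hd] at hx
      exact ⟨⟨by omega, by omega, by omega, by omega, by omega, by omega⟩, by omega⟩
    · rw [dentCount_add_one_of_not_dent hd] at hx
      exact ⟨⟨by omega, by omega, by omega, by omega, by omega, fun hd' => hd hd'.2⟩, by omega⟩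
  -- Forgetting the orientation is harmless, as only down-pointing partners are compared.
  let coords : Triangle → Σ _ : ℤ, ℤ
    | .up i k => ⟨k, i⟩
    | .down i k => ⟨k, i⟩
  have hdown : ∀ x ∈ upsSouth a b u (u j), ∃ i k, f (.up x.2 x.1) = .down i k ∧
      (⟨k, i⟩ : Σ _ : ℤ, ℤ) ∈ downsSouth a b n (u j) := by
    intro x hx
    obtain ⟨hx1, hx2⟩ := hups x hx
    obtain ⟨hm, hadj⟩ := hf _ hx1
    obtain ⟨i, k, he, hk⟩ := hadj.exists_down
    rw [he, down_mem_dentedHalfHexagon] at hm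
    refine ⟨i, k, he, ?_⟩
    simp only [downsSouth, Finset.mem_sigma, Finset.mem_Ico]
    omega
  have hcard : (upsSouth a b u (u j)).card ≤ (downsSouth a b n (u j)).card := by
    refine Finset.card_le_card_of_injOn (fun x => coords (f (.up x.2 x.1))) ?_ ?_
    · intro x hx
      obtain ⟨i, k, he, hm⟩ := hdown x hx
      simpa [he, coords] using hm
    · rintro ⟨r, s⟩ hx ⟨r', s'⟩ hy hxy
      obtain ⟨i, k, he, -⟩ := hdown _ hx
      obtain ⟨i', k', he', -⟩ := hdown _ hy
      simp only [he, he', coords, Sigma.mk.injEq, heq_eq_eq] at hxy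
      obtain ⟨rfl, rfl⟩ := hxy
      have := hinj (hups _ hx).1 (hups _ hy).1 (he.trans he'.symm)
      simp only [Triangle.up.injEq] at this
      obtain ⟨rfl, rfl⟩ := this
      rfl
  have := card_upsSouth_sub_card_downsSouth (a := a) hu (k₀ := u j) (by omega) (by omega)
    (by omega)
  rw [dentCount_apply hu.1] at this
  omega

/-- A dented half-hexagon is tileable if and only if its `j`-th dent from the north is at position
`2 * j` or further south. -/
theorem tileable_dentedHalfHexagon_iff (hu : IsDentVector (b + 2 * n) u) :
    Tileable (dentedHalfHexagon a b n u) ↔ ∀ j : Fin n, 2 * ((j : ℤ) + 1) ≤ u j :=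
  ⟨fun h j => two_mul_le_of_tileable hu h j, tileable_dentedHalfHexagon hu⟩

end

end LozengeTiling

theorem mainTheorem7 (n a b a' b' : ℕ) (u u' : Fin n → ℤ)
    (hu : LozengeTiling.IsDentVector (b + 2 * n) u)
    (hu' : LozengeTiling.IsDentVector (b' + 2 * n) u')
    (hle : ∀ i, u i ≤ u' i)
    (h : LozengeTiling.Tileable (LozengeTiling.dentedHalfHexagon a b n u)) :
    LozengeTiling.Tileable (LozengeTiling.dentedHalfHexagon a' b' n u') :=
  (LozengeTiling.tileable_dentedHalfHexagon_iff hu').2 fun j =>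
    ((LozengeTiling.tileable_dentedHalfHexagon_iff hu).1 h j).trans (hle j)
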